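/- A function $f:Z\to X$ between topological spaces is quasicontinuous if for every $z\in Z$, every neighborhood $O$ of $z$ and every neighborhood $W$ of $f(z)$ there is a non-empty open set $U\subseteq O$ with $f(U)\subseteq W$. For a class $\mathcal C$ of Baire spaces, a topological space $X$ is called $\mathcal C$-Piotrowski if every quasicontinuous map $f:C\to X$ defined on a non-empty space $C\in\mathcal C$ has a continuity point; $X$ is Piotrowski if this holds for the class $\mathcal C$ of all Baire spaces. The weight $w(X)$ is the least cardinality of a base of $X$, and the density of a space is the least cardinality of a dense subset. In the Choquet game on $X$ the players $\alpha$ and $\beta$ choose in turn non-empty open sets $U_0\supseteq V_0\supseteq U_1\supseteq V_1\supseteq\cdots$, where $\alpha$ chooses the sets $U_n$, starting with $U_0=X$, and $\beta$ chooses the sets $V_n$; the player $\alpha$ wins if $\bigcap_n U_n\neq\emptyset$. The space $X$ is called Choquet if $\alpha$ has a winning strategy (the empty space is Choquet). Theorem. Let $X$ be a Tychonoff space. (1) Suppose that $X$ is $\mathcal C$-Piotrowski for the class $\mathcal C$ of Baire metrizable spaces of density $\le w(X)$. Then $X$ contains a dense completely metrizable subspace if and only if $X$ is Choquet. Moreover,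 $X$ contains a completely metrizable subspace that is a dense $G_\delta$-subset of $X$ if and only if $X$ is Choquet. (2) Suppose that $X$ is Piotrowski. Then $X$ contains a dense metrizable Baire subspace if and only if $X$ is Baire, and $X$ contains a dense completely metrizable subspace if and only if $X$ is Choquet. -/

import Mathlib

universe u v

open Set Topology

namespace Piot

/-- The weight of a topological space: the least cardinality of a base of its topology. -/
noncomputable def weight (X : Type u) [TopologicalSpace X] : Cardinal.{u} :=
  sInf {κ | ∃ B : Set (Set X), TopologicalSpace.IsTopologicalBasis B ∧ Cardinal.mk B = κ}

/-- The density of a topological space: the least cardinality of a dense subset. -/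
noncomputable def density (X : Type u) [TopologicalSpace X] : Cardinal.{u} :=
  sInf {κ | ∃ D : Set X, Dense D ∧ Cardinal.mk D = κ}

/-- A function is quasicontinuous if for every point `x`, every neighborhood `O` of `x` and every
neighborhood `W` of `f x`, some nonempty open set `U ⊆ O` is mapped into `W`. -/
def Quasicontinuous {Z : Type u} {X : Type v} [TopologicalSpace Z] [TopologicalSpace X]
    (f : Z → X) : Prop :=
  ∀ x : Z, ∀ O ∈ 𝓝 x, ∀ W ∈ 𝓝 (f x), ∃ U : Set Z, IsOpen U ∧ U.Nonempty ∧ U ⊆ O ∧ MapsTo f U W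

/-- `X` is `C`-Piotrowski if every quasicontinuous map to `X` from a nonempty space
in the class `C` has a continuity point. -/
def IsPiotrowskiFor (C : ∀ (Z : Type u) [TopologicalSpace Z], Prop)
    (X : Type v) [TopologicalSpace X] : Prop :=
  ∀ (Z : Type u) [TopologicalSpace Z], C Z → Nonempty Z →
    ∀ f : Z → X, Quasicontinuous f → ∃ z : Z, ContinuousAt f z

/-- The class of Baire metrizable spaces of density at most `κ`. -/
def BaireMetrizableOfDensityLE (κ : Cardinal.{u}) (Z : Type u) [TopologicalSpace Z] : Prop :=
  BaireSpace Z ∧ TopologicalSpace.MetrizableSpace Z ∧ density Z ≤ κ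

/-- `X` is Piotrowski if it is `C`-Piotrowski for the class `C` of all Baire spaces. -/
def IsPiotrowski (X : Type u) [TopologicalSpace X] : Prop :=
  IsPiotrowskiFor.{u, u} (fun Z _ => BaireSpace Z) X

/-- `(U 0, V 0, …, U (n-1), V (n-1))` is a partial play of the Choquet game on `X`: a decreasing
sequence of nonempty open sets, starting with `U 0 = X`. -/
structure IsPartialPlay {X : Type u} [TopologicalSpace X]
    (U V : ℕ → TopologicalSpace.Opens X) (n : ℕ) : Prop where
  start : 0 < n → U 0 = ⊤
  nonempty_left : ∀ i < n, (U i : Set X).Nonempty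
  nonempty_right : ∀ i < n, (V i : Set X).Nonempty
  right_le_left : ∀ i < n, V i ≤ U i
  left_le_right : ∀ i, i + 1 < n → U (i + 1) ≤ V i

/-- The list of the moves made in the first `n` rounds, in chronological order. -/
def history {X : Type u} [TopologicalSpace X]
    (U V : ℕ → TopologicalSpace.Opens X) (n : ℕ) :
    List (TopologicalSpace.Opens X × TopologicalSpace.Opens X) :=
  (List.range n).map fun i => (U i, V i)

/-- `σ` is a winning strategy of the player `α` in the Choquet game on `X`. The first move of `α`
is `X` itself; afterwards `σ` answers every partial play by a nonempty open subset of the last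
move of `β`, and every infinite play in which `α` follows `σ` has nonempty intersection. -/
structure IsWinningStrategy {X : Type u} [TopologicalSpace X]
    (σ : List (TopologicalSpace.Opens X × TopologicalSpace.Opens X) →
      TopologicalSpace.Opens X) : Prop where
  legal : ∀ (U V : ℕ → TopologicalSpace.Opens X) (n : ℕ), IsPartialPlay U V (n + 1) →
    (σ (history U V (n + 1)) : Set X).Nonempty ∧ σ (history U V (n + 1)) ≤ V n
  wins : ∀ U V : ℕ → TopologicalSpace.Opens X, (∀ n, IsPartialPlay U V n) →
    (∀ n, U (n + 1) = σ (history U V (n + 1))) → (⋂ n, (U n : Set X)).Nonempty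

/-- `X` is Choquet if the player `α` has a winning strategy in the Choquet game on `X`. -/
def IsChoquet (X : Type u) [TopologicalSpace X] : Prop :=
  ∃ σ : List (TopologicalSpace.Opens X × TopologicalSpace.Opens X) → TopologicalSpace.Opens X,
    IsWinningStrategy σ

end Piot

/-! Let `X` be Baire and Piotrowski, with an infinite base indexed by `B`. Sequences in `B` whose
members have a common point form a subspace of the countable power of the discrete space `B`, so it
and all its subspaces have density at most that of the index set. Choosing a common point for each
sequence is quasicontinuous (`CenteredSeq.quasicontinuous_point`). Although this sequence space need
not be Baire, the map is continuous on a residual set (`IsPiotrowskiFor.exists_dense_open`):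
otherwise its discontinuity points in some open set form a Baire space, where the restricted map has
a continuity point, contrary to regularity.

At a continuity point the finite intersections of the sequence shrink to its value. A tree of such
intersections, steered into the dense open sets, yields disjoint open families with dense unions
whose branches are neighborhood bases (`IsBasicLevels`). The points in all levels form a dense
metrizable Gδ set. If `X` is Choquet, the tree is rebuilt from positions of the game, refining these
levels; branches are then plays won by `α`, which makes the Gδ set completely metrizable.
Conversely, on a regular space `α` wins by shrinking closures and the diameters of traces on a dense
complete subspace. -/

namespace Piot

variable {X : Type u} [TopologicalSpace X]

/-! ### Disjoint refinements and trees of open sets -/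

/-- A family of nonempty open sets that is cofinal below an open set `O` contains a disjoint
subfamily whose union is dense in `O`. -/
theorem exists_pairwiseDisjoint_dense {ι : Type v} (U : ι → Set X) (S : Set ι) (O : Set X)
    (hO : IsOpen O) (hne : ∀ i ∈ S, (U i).Nonempty)
    (hS : ∀ W : Set X, IsOpen W → W.Nonempty → W ⊆ O → ∃ i ∈ S, U i ⊆ W) :
    ∃ T ⊆ S, T.PairwiseDisjoint U ∧ O ⊆ closure (⋃ i ∈ T, U i) := by
  obtain ⟨T, hT⟩ := zorn_subset {T : Set ι | T ⊆ S ∧ T.PairwiseDisjoint U} (by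
    intro c hc hch
    refine ⟨⋃₀ c, ⟨sUnion_subset fun t ht => (hc ht).1, ?_⟩, fun s hs => subset_sUnion_of_mem hs⟩
    exact (pairwiseDisjoint_sUnion hch.directedOn).2 fun t ht => (hc ht).2)
  refine ⟨T, hT.prop.1, hT.prop.2, ?_⟩
  by_contra hcon
  obtain ⟨x, hxO, hx⟩ := not_subset.1 hcon
  obtain ⟨i, hiS, hi⟩ := hS (O ∩ (closure (⋃ i ∈ T, U i))ᶜ)
    (hO.inter isClosed_closure.isOpen_compl) ⟨x, hxO, hx⟩ inter_subset_left
  have hdisj : ∀ j ∈ T, Disjoint (U i) (U j) := by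
    intro j hj
    rw [Set.disjoint_left]
    intro y hy hyj
    exact (hi hy).2 (subset_closure (mem_biUnion hj hyj))
  have hins : insert i T ∈ {T : Set ι | T ⊆ S ∧ T.PairwiseDisjoint U} :=
    ⟨insert_subset hiS hT.prop.1, hT.prop.2.insert fun j hj _ => hdisj j hj⟩
  have hiT : i ∈ T := hT.le_of_ge hins (subset_insert i T) (mem_insert i T)
  obtain ⟨y, hy⟩ := hne i hiS
  exact Set.disjoint_left.1 (hdisj i hiT) hy hy

/-- A tree of nonempty open sets in which the successors of every node are cofinal below it has
disjoint levels with dense unions. -/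
theorem exists_disjoint_levels {N : Type v} (U : N → Set X) (hUo : ∀ t, IsOpen (U t))
    (hUne : ∀ t, (U t).Nonempty) (R : ℕ → N → N → Prop) (root : N) (hroot : U root = univ)
    (hR : ∀ k t t', R k t t' → U t' ⊆ U t)
    (hd : ∀ k t, ∀ W : Set X, IsOpen W → W.Nonempty → W ⊆ U t → ∃ t', R k t t' ∧ U t' ⊆ W) :
    ∃ T : ℕ → Set N, (∀ k, (T k).PairwiseDisjoint U) ∧ (∀ k, Dense (⋃ t ∈ T k, U t)) ∧
      ∀ c : ℕ → N, (∀ k, c k ∈ T k) → (∀ k, (U (c k) ∩ U (c (k + 1))).Nonempty) →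
        c 0 = root ∧ ∀ k, R k (c k) (c (k + 1)) := by
  choose M hMS hMd hMc using fun k t => exists_pairwiseDisjoint_dense U {t' | R k t t'} (U t)
    (hUo t) (fun i _ => hUne i) (hd k t)
  let T : ℕ → Set N := fun k => Nat.rec {root} (fun k S => ⋃ t ∈ S, M k t) k
  have hT : ∀ k t', t' ∈ T (k + 1) ↔ ∃ t ∈ T k, t' ∈ M k t := by
    intro k t'
    change t' ∈ ⋃ t ∈ T k, M k t ↔ _
    simp
  have hdisj : ∀ k, (T k).PairwiseDisjoint U := by
    intro k
    induction k with
    | zero => exact pairwiseDisjoint_singleton root U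
    | succ k ih =>
      intro a ha b hb hab
      obtain ⟨s, hs, has⟩ := (hT k a).1 ha
      obtain ⟨t, ht, hbt⟩ := (hT k b).1 hb
      by_cases hst : s = t
      · subst hst
        exact hMd k s has hbt hab
      · exact (ih hs ht hst).mono (hR k _ _ (hMS k s has)) (hR k _ _ (hMS k t hbt))
  refine ⟨T, hdisj, ?_, ?_⟩
  · intro k
    induction k with
    | zero =>
      have : (⋃ t ∈ T 0, U t) = univ := by
        change (⋃ t ∈ ({root} : Set N), U t) = univ
        simp [hroot]
      rw [this]
      exact dense_univ
    | succ k ih =>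
      refine dense_iff_closure_eq.2 (univ_subset_iff.1 ?_)
      rw [← ih.closure_eq]
      refine closure_minimal (iUnion₂_subset fun t ht => (hMc k t).trans (closure_mono ?_))
        isClosed_closure
      exact iUnion₂_subset fun t' ht' => subset_biUnion_of_mem (u := U) ((hT k t').2 ⟨t, ht, ht'⟩)
  · intro c hc hne
    refine ⟨hc 0, fun k => ?_⟩
    obtain ⟨t, ht, hct⟩ := (hT k _).1 (hc (k + 1))
    have hr : R k t (c (k + 1)) := hMS k t hct
    obtain ⟨x, hx, hx'⟩ := hne k
    -- Disjointness of level `k` makes parents unique, so it suffices that consecutive sets meet.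
    have : t = c k := (hdisj k).elim_set ht (hc k) x (hR k _ _ hr hx') hx
    rwa [this] at hr

/-! ### Metrizability from basic levels -/

/-- A sequence of disjoint families of open sets with dense unions such that every point that
lies in members of all families has a neighborhood base consisting of these members. -/
structure IsBasicLevels (F : ℕ → Set (Set X)) : Prop where
  isOpen : ∀ k, ∀ w ∈ F k, IsOpen w
  disjoint : ∀ k, (F k).PairwiseDisjoint id
  dense : ∀ k, Dense (⋃₀ F k)
  base : ∀ (w : ℕ → Set X) (x : X), (∀ k, w k ∈ F k) → (∀ k, x ∈ w k) →
    ∀ W ∈ 𝓝 x, ∃ k, w k ⊆ W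

namespace IsBasicLevels

variable {F : ℕ → Set (Set X)}

theorem isOpen_sUnion (hF : IsBasicLevels F) (k : ℕ) : IsOpen (⋃₀ F k) :=
  _root_.isOpen_sUnion (hF.isOpen k)

theorem isGδ (hF : IsBasicLevels F) : IsGδ (⋂ k, ⋃₀ F k) :=
  IsGδ.iInter_of_isOpen hF.isOpen_sUnion

theorem dense_iInter [BaireSpace X] (hF : IsBasicLevels F) : Dense (⋂ k, ⋃₀ F k) :=
  dense_iInter_of_isOpen_nat hF.isOpen_sUnion hF.dense

/-- The points in members of all families embed into a product of discrete spaces. -/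
theorem exists_isEmbedding [T2Space X] (hF : IsBasicLevels F) [TopologicalSpace (Set X)]
    [DiscreteTopology (Set X)] :
    ∃ τ : (⋂ k, ⋃₀ F k : Set X) → ℕ → Set X, IsEmbedding τ ∧
      ∀ x k, τ x k ∈ F k ∧ (x : X) ∈ τ x k := by
  have h : ∀ (x : (⋂ k, ⋃₀ F k : Set X)) (k : ℕ), ∃ w ∈ F k, (x : X) ∈ w :=
    fun x k => mem_iInter.1 x.2 k
  choose τ hτ hxτ using h
  refine ⟨τ, ⟨isInducing_iff_nhds.2 fun x => ?_, fun x y hxy => ?_⟩,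
    fun x k => ⟨hτ x k, hxτ x k⟩⟩
  · have hcyl : ∀ n, PiNat.cylinder (τ x) n ∈ 𝓝 (τ x) := fun n =>
      (PiNat.isOpen_cylinder (E := fun _ : ℕ => Set X) _ n).mem_nhds (PiNat.self_mem_cylinder _ n)
    apply le_antisymm
    · rw [← Filter.tendsto_iff_comap]
      refine tendsto_pi_nhds.2 fun k => ?_
      rw [nhds_discrete (Set X), Filter.tendsto_pure]
      have : ∀ᶠ y : (⋂ k, ⋃₀ F k : Set X) in 𝓝 x, (y : X) ∈ τ x k :=
        continuous_subtype_val.continuousAt ((hF.isOpen k _ (hτ x k)).mem_nhds (hxτ x k))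
      filter_upwards [this] with y hy
      exact (hF.disjoint k).elim_set (hτ y k) (hτ x k) y (hxτ y k) hy
    · intro s hs
      obtain ⟨W, hW, hWs⟩ := mem_nhds_subtype _ _ _ |>.1 hs
      obtain ⟨k, hk⟩ := hF.base (τ x) x (hτ x) (hxτ x) W hW
      refine ⟨_, hcyl (k + 1), fun y hy => hWs (hk ?_)⟩
      rw [← PiNat.mem_cylinder_iff.1 hy k (Nat.lt_succ_self k)]
      exact hxτ y k
  · by_contra hne
    have hne' : (x : X) ≠ y := fun h => hne (Subtype.ext h)
    obtain ⟨k, hk⟩ := hF.base (τ x) x (hτ x) (hxτ x) {(y : X)}ᶜ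
      (isOpen_compl_singleton.mem_nhds hne')
    have hy := hxτ y k
    rw [← hxy] at hy
    exact hk hy rfl

theorem metrizableSpace [T2Space X] (hF : IsBasicLevels F) :
    TopologicalSpace.MetrizableSpace (⋂ k, ⋃₀ F k : Set X) := by
  let : TopologicalSpace (Set X) := ⊥
  have : DiscreteTopology (Set X) := ⟨rfl⟩
  obtain ⟨τ, hτ, -⟩ := hF.exists_isEmbedding
  exact hτ.metrizableSpace

/-- The image in the countable power of a discrete space is closed: every finite part of a limit
sequence is realized by a point, so consecutive members meet, and `hc` supplies a point with exactly
these coordinates. -/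
theorem isCompletelyMetrizableSpace [T2Space X] (hF : IsBasicLevels F)
    (hc : ∀ w : ℕ → Set X, (∀ k, w k ∈ F k) → (∀ k, (w k ∩ w (k + 1)).Nonempty) →
      (⋂ k, w k).Nonempty) :
    TopologicalSpace.IsCompletelyMetrizableSpace (⋂ k, ⋃₀ F k : Set X) := by
  let : TopologicalSpace (Set X) := ⊥
  have : DiscreteTopology (Set X) := ⟨rfl⟩
  obtain ⟨τ, hτ, hτF⟩ := hF.exists_isEmbedding
  refine IsClosedEmbedding.IsCompletelyMetrizableSpace
    ⟨hτ, isClosed_of_closure_subset fun c hcl => ?_⟩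
  have happ : ∀ n, ∃ x, ∀ i < n, τ x i = c i := by
    intro n
    obtain ⟨_, hy, x, rfl⟩ := mem_closure_iff.1 hcl _
      (PiNat.isOpen_cylinder (E := fun _ : ℕ => Set X) c n) (PiNat.self_mem_cylinder _ n)
    exact ⟨x, PiNat.mem_cylinder_iff.1 hy⟩
  have hcF : ∀ k, c k ∈ F k := fun k => by
    obtain ⟨x, hx⟩ := happ (k + 1)
    rw [← hx k (Nat.lt_succ_self k)]
    exact (hτF x k).1
  obtain ⟨x, hx⟩ := hc c hcF fun k => by
    obtain ⟨x, hx⟩ := happ (k + 2)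
    rw [← hx k (by omega), ← hx (k + 1) (by omega)]
    exact ⟨x, (hτF x k).2, (hτF x (k + 1)).2⟩
  have hx' := mem_iInter.1 hx
  refine ⟨⟨x, mem_iInter.2 fun k => ⟨c k, hcF k, hx' k⟩⟩, funext fun k => ?_⟩
  exact (hF.disjoint k).elim_set (hτF _ k).1 (hcF k) x (hτF _ k).2 (hx' k)

end IsBasicLevels

/-- The levels of a tree of open sets are basic if every branch of the tree is a neighborhood base
at each point of its intersection. -/
theorem exists_isBasicLevels_of_tree {N : Type v} (U : N → Set X) (hUo : ∀ t, IsOpen (U t))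
    (hUne : ∀ t, (U t).Nonempty) (R : ℕ → N → N → Prop) (root : N) (hroot : U root = univ)
    (hR : ∀ k t t', R k t t' → U t' ⊆ U t)
    (hd : ∀ k t, ∀ W : Set X, IsOpen W → W.Nonempty → W ⊆ U t → ∃ t', R k t t' ∧ U t' ⊆ W)
    (hb : ∀ c : ℕ → N, c 0 = root → (∀ k, R k (c k) (c (k + 1))) → ∀ x, (∀ k, x ∈ U (c k)) →
      ∀ W ∈ 𝓝 x, ∃ k, U (c k) ⊆ W) :
    ∃ F : ℕ → Set (Set X), IsBasicLevels F ∧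
      ∀ w : ℕ → Set X, (∀ k, w k ∈ F k) → (∀ k, (w k ∩ w (k + 1)).Nonempty) →
        ∃ c : ℕ → N, (∀ k, w k = U (c k)) ∧ c 0 = root ∧ ∀ k, R k (c k) (c (k + 1)) := by
  obtain ⟨T, hdisj, hdense, hT⟩ := exists_disjoint_levels U hUo hUne R root hroot hR hd
  have key : ∀ w : ℕ → Set X, (∀ k, w k ∈ U '' T k) → (∀ k, (w k ∩ w (k + 1)).Nonempty) →
      ∃ c : ℕ → N, (∀ k, w k = U (c k)) ∧ c 0 = root ∧ ∀ k, R k (c k) (c (k + 1)) := by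
    intro w hw hne
    choose c hc hcw using hw
    refine ⟨c, fun k => (hcw k).symm, hT c hc fun k => ?_⟩
    rw [hcw, hcw]
    exact hne k
  refine ⟨fun k => U '' T k, ⟨?_, ?_, ?_, ?_⟩, key⟩
  · rintro k _ ⟨t, -, rfl⟩
    exact hUo t
  · rintro k _ ⟨s, hs, rfl⟩ _ ⟨t, ht, rfl⟩ hst
    exact hdisj k hs ht fun h => hst (congrArg U h)
  · intro k
    rw [sUnion_image]
    exact hdense k
  · intro w x hw hx
    obtain ⟨c, hcw, h0, hc⟩ := key w hw fun k => ⟨x, hx k, hx (k + 1)⟩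
    simp only [hcw] at hx ⊢
    exact hb c h0 hc x hx

/-! ### Quasicontinuity and dense subsets -/

section Quasicontinuous

variable {Z : Type u} {X : Type v} [TopologicalSpace Z] [TopologicalSpace X] {f : Z → X}
  {A O : Set Z}

theorem Quasicontinuous.restrict (hf : Quasicontinuous f) (hO : IsOpen O) (hAO : A ⊆ O)
    (hOA : O ⊆ closure A) : Quasicontinuous fun a : A => f a := by
  intro x P hP W hW
  obtain ⟨Q, hQ, hQP⟩ := (mem_nhds_subtype _ _ _).1 hP
  obtain ⟨U, hUo, ⟨y, hy⟩, hUQ, hUW⟩ :=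
    hf x (Q ∩ O) (Filter.inter_mem hQ (hO.mem_nhds (hAO x.2))) W hW
  obtain ⟨z, hzU, hzA⟩ := mem_closure_iff.1 (hOA (hUQ hy).2) U hUo hy
  exact ⟨Subtype.val ⁻¹' U, hUo.preimage continuous_subtype_val, ⟨⟨z, hzA⟩, hzU⟩,
    fun a ha => hQP (hUQ ha).1, fun a ha => hUW ha⟩

/-- A quasicontinuous map to a regular space is continuous at the continuity points of its
restriction to a dense subset. -/
theorem Quasicontinuous.continuousAt_of_restrict [RegularSpace X] (hf : Quasicontinuous f)
    (hO : IsOpen O) (hAO : A ⊆ O) (hOA : O ⊆ closure A) (a : A)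
    (ha : ContinuousAt (fun a : A => f a) a) : ContinuousAt f a := by
  rw [ContinuousAt, (closed_nhds_basis (f a)).tendsto_right_iff]
  rintro W ⟨hW, hWc⟩
  obtain ⟨Q, hQ, hQW⟩ := (mem_nhds_subtype _ _ _).1 (ha hW)
  obtain ⟨P, hPQ, hPo, haP⟩ := mem_nhds_iff.1 hQ
  filter_upwards [(hPo.inter hO).mem_nhds ⟨haP, hAO a.2⟩] with z hz
  -- A value outside the closed set `W` would be shared, up to staying outside `W`, by a whole open
  -- set near `a`; that set meets `A`, where nearby values lie in `W`.
  by_contra hzW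
  obtain ⟨U, hUo, ⟨y, hy⟩, hUP, hUW⟩ :=
    hf z (P ∩ O) ((hPo.inter hO).mem_nhds hz) Wᶜ (hWc.isOpen_compl.mem_nhds hzW)
  obtain ⟨b, hbU, hbA⟩ := mem_closure_iff.1 (hOA (hUP hy).2) U hUo hy
  exact hUW hbU (hQW (a := ⟨b, hbA⟩) (hPQ (hUP hbU).1))

end Quasicontinuous

/-! ### Residual sets and nowhere meager sets -/

section Category

variable {Z : Type u} [TopologicalSpace Z]

/-- A set is residual if below every nonempty open set there is one in which it is residual. -/
theorem exists_dense_open_of_local (C : Set Z)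
    (h : ∀ O : Set Z, IsOpen O → O.Nonempty → ∃ W ⊆ O, IsOpen W ∧ W.Nonempty ∧
      ∃ D : ℕ → Set Z, (∀ n, IsOpen (D n)) ∧ (∀ n, Dense (D n)) ∧ W ∩ ⋂ n, D n ⊆ C) :
    ∃ D : ℕ → Set Z, (∀ n, IsOpen (D n)) ∧ (∀ n, Dense (D n)) ∧ ⋂ n, D n ⊆ C := by
  obtain ⟨T, hTS, hTd, hTc⟩ := exists_pairwiseDisjoint_dense (fun W : Set Z => W)
    {W | IsOpen W ∧ W.Nonempty ∧
      ∃ D : ℕ → Set Z, (∀ n, IsOpen (D n)) ∧ (∀ n, Dense (D n)) ∧ W ∩ ⋂ n, D n ⊆ C}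
    univ isOpen_univ (fun W hW => hW.2.1) fun W hWo hW _ => by
      obtain ⟨V, hVW, hV⟩ := h W hWo hW
      exact ⟨V, hV, hVW⟩
  have hT : ∀ W : T, ∃ D : ℕ → Set Z, (∀ n, IsOpen (D n)) ∧ (∀ n, Dense (D n)) ∧
      (W : Set Z) ∩ ⋂ n, D n ⊆ C := fun W => (hTS W.2).2.2
  choose D hDo hDd hDC using hT
  refine ⟨fun n => ⋃ W : T, (W : Set Z) ∩ D W n, fun n => isOpen_iUnion fun W =>
    (hTS W.2).1.inter (hDo W n), fun n x => ?_, fun x hx => ?_⟩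
  · refine closure_minimal (iUnion₂_subset fun W hW => ?_) isClosed_closure (hTc (mem_univ x))
    refine ((hDd ⟨W, hW⟩ n).open_subset_closure_inter (hTS hW).1).trans (closure_mono ?_)
    exact subset_iUnion (fun W : T => (W : Set Z) ∩ D W n) ⟨W, hW⟩
  · have hx' : ∀ n, ∃ W : T, x ∈ (W : Set Z) ∩ D W n := fun n => mem_iUnion.1 (mem_iInter.1 hx n)
    choose W hW using hx'
    -- The pieces are disjoint, so the same piece serves all `n`.
    refine hDC (W 0) ⟨(hW 0).1, mem_iInter.2 fun n => ?_⟩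
    have : W n = W 0 := Subtype.ext (hTd.elim_set (W n).2 (W 0).2 x (hW n).1 (hW 0).1)
    exact this ▸ (hW n).2

/-- The part of a set in an open set in which it is everywhere nonmeager is a Baire space that is
dense in the open set. -/
theorem baireSpace_of_nowhere_meager (C O : Set Z)
    (h : ∀ W ⊆ O, IsOpen W → W.Nonempty → ∀ D : ℕ → Set Z, (∀ n, IsOpen (D n)) →
      (∀ n, Dense (D n)) → ¬ W ∩ ⋂ n, D n ⊆ C) (hO : IsOpen O) :
    O ⊆ closure (Cᶜ ∩ O) ∧ BaireSpace (Cᶜ ∩ O : Set Z) := by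
  have hcl : O ⊆ closure (Cᶜ ∩ O) := by
    intro x hx
    refine mem_closure_iff.2 fun W hW hxW => ?_
    obtain ⟨y, hy, hyC⟩ := not_subset.1 (h (W ∩ O) inter_subset_right (hW.inter hO) ⟨x, hxW, hx⟩
      (fun _ => univ) (fun _ => isOpen_univ) fun _ => dense_univ)
    exact ⟨y, hy.1.1, hyC, hy.1.2⟩
  refine ⟨hcl, ⟨fun D hDo hDd => ?_⟩⟩
  choose E hEo hED using fun n => isOpen_induced_iff.1 (hDo n)
  refine dense_iff_inter_open.2 ?_
  rintro _ ⟨P, hPo, rfl⟩ ⟨x, hx⟩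
  set W := P ∩ O with hWdef
  have hWo : IsOpen W := hPo.inter hO
  -- Adding the exterior of `W` makes `E n` dense in all of `Z` without changing it on `W`.
  obtain ⟨y, ⟨hyW, hyE⟩, hyC⟩ := not_subset.1 (h W inter_subset_right hWo ⟨x, hx, x.2.2⟩
    (fun n => E n ∪ (closure W)ᶜ) (fun n => (hEo n).union isClosed_closure.isOpen_compl) (by
      intro n
      refine dense_iff_inter_open.2 fun V hV hVne => ?_
      by_cases hVW : (V ∩ W).Nonempty
      · obtain ⟨z, hz⟩ := hVW
        obtain ⟨a, ha, haA⟩ := mem_closure_iff.1 (hcl hz.2.2) _ (hV.inter hWo) hz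
        obtain ⟨b, hb, hbD⟩ := dense_iff_inter_open.1 (hDd n)
          (Subtype.val ⁻¹' (V ∩ W)) ((hV.inter hWo).preimage continuous_subtype_val)
          ⟨⟨a, haA⟩, ha⟩
        rw [← hED n] at hbD
        exact ⟨b, hb.1, Or.inl hbD⟩
      · obtain ⟨z, hz⟩ := hVne
        refine ⟨z, hz, Or.inr fun hzc => hVW ?_⟩
        exact mem_closure_iff.1 hzc V hV hz))
  refine ⟨⟨y, hyC, hyW.2⟩, hyW.1, mem_iInter.2 fun n => ?_⟩
  rw [← hED n]
  exact (mem_iInter.1 hyE n).resolve_right fun hn => hn (subset_closure hyW)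

end Category

/-- A quasicontinuous map from a metrizable space of small hereditary density to a regular
Piotrowski space is continuous at all points of the intersection of some sequence of dense open
sets. -/
theorem IsPiotrowskiFor.exists_dense_open {X : Type v} [TopologicalSpace X] [RegularSpace X]
    {κ : Cardinal.{u}} (hX : IsPiotrowskiFor.{u, v} (BaireMetrizableOfDensityLE κ) X)
    {Z : Type u} [TopologicalSpace Z] [TopologicalSpace.MetrizableSpace Z]
    (hZ : ∀ A : Set Z, density A ≤ κ) {f : Z → X} (hf : Quasicontinuous f) :
    ∃ D : ℕ → Set Z, (∀ n, IsOpen (D n)) ∧ (∀ n, Dense (D n)) ∧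
      ⋂ n, D n ⊆ {z | ContinuousAt f z} := by
  apply exists_dense_open_of_local
  by_contra! hcon
  obtain ⟨O, hO, ⟨x, hx⟩, h⟩ := hcon
  obtain ⟨hcl, hB⟩ := baireSpace_of_nowhere_meager {z | ContinuousAt f z} O h hO
  obtain ⟨y, -, hy⟩ := mem_closure_iff.1 (hcl hx) O hO hx
  obtain ⟨a, ha⟩ := hX ({z | ContinuousAt f z}ᶜ ∩ O : Set Z) ⟨hB, inferInstance, hZ _⟩ ⟨⟨y, hy⟩⟩ _
    (hf.restrict hO inter_subset_right hcl)
  exact a.2.1 (hf.continuousAt_of_restrict hO inter_subset_right hcl a ha)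

/-! ### Hereditary density in powers of discrete spaces -/

theorem density_le {Z : Type u} [TopologicalSpace Z] {D : Set Z} (hD : Dense D) :
    density Z ≤ Cardinal.mk D :=
  csInf_le' ⟨D, hD, rfl⟩

/-- The hereditary density of a space that embeds into a countable power of a discrete space. -/
theorem density_le_of_isInducing {B Z : Type u} [Infinite B] [TopologicalSpace B]
    [DiscreteTopology B] [TopologicalSpace Z] {e : Z → ℕ → B} (he : IsInducing e) :
    density Z ≤ Cardinal.mk B := by
  classical
  rcases isEmpty_or_nonempty Z with hZ | ⟨⟨z₀⟩⟩
  · refine (density_le (D := ∅) fun z => hZ.elim z).trans ?_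
    simp
  -- One point per finite word that occurs as an initial segment; `z₀` is a dummy for the others. An
  -- infinite `B` has as many finite words as elements.
  let g : List B → Z := fun l =>
    if h : ∃ z, PiNat.res (e z) l.length = l then h.choose else z₀
  refine (density_le (D := range g) ?_).trans
    (Cardinal.mk_range_le.trans (Cardinal.mk_list_eq_mk B).le)
  intro z
  refine mem_closure_iff_nhds.2 fun W hW => ?_
  rw [he.nhds_eq_comap] at hW
  obtain ⟨V, hV, hVW⟩ := hW
  obtain ⟨_, ⟨y, n, rfl⟩, hzc, hcV⟩ :=
    (PiNat.isTopologicalBasis_cylinders fun _ : ℕ => B).mem_nhds_iff.1 hV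
  have hex : ∃ z', PiNat.res (e z') (PiNat.res (e z) n).length = PiNat.res (e z) n :=
    ⟨z, by rw [PiNat.res_length]⟩
  refine ⟨g (PiNat.res (e z) n), hVW (hcV ?_), mem_range_self _⟩
  have hg : g (PiNat.res (e z) n) = hex.choose := dif_pos hex
  have hs := hex.choose_spec
  rw [← hg, PiNat.res_length, PiNat.res_eq_res] at hs
  intro i hi
  rw [hs hi, hzc i hi]

/-! ### The space of centered sequences of basic sets -/

section BasicSequences

variable {X : Type u} {B : Type u} {b : B → Set X}

/-- The sequences of members of an indexed family of sets that have a common point. -/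
@[ext]
structure CenteredSeq (b : B → Set X) : Type u where
  /-- The underlying sequence. -/
  seq : ℕ → B
  nonempty : (⋂ i, b (seq i)).Nonempty

namespace CenteredSeq

/-- The intersection of the first `n` members of a sequence. -/
def head (z : CenteredSeq b) (n : ℕ) : Set X := ⋂ i, ⋂ _ : i < n, b (z.seq i)

theorem mem_head {z : CenteredSeq b} {n : ℕ} {x : X} : x ∈ z.head n ↔ ∀ i < n, x ∈ b (z.seq i) := by
  simp [head]

theorem head_congr {z z' : CenteredSeq b} {n : ℕ} (h : ∀ i < n, z'.seq i = z.seq i) :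
    z'.head n = z.head n := by
  ext x
  simp only [mem_head]
  exact forall₂_congr fun i hi => by rw [h i hi]

theorem head_anti (z : CenteredSeq b) {m n : ℕ} (h : m ≤ n) : z.head n ⊆ z.head m :=
  fun _ hx => mem_head.2 fun i hi => mem_head.1 hx i (hi.trans_le h)

/-- A point in the intersection of a sequence. -/
noncomputable def point (z : CenteredSeq b) : X := z.nonempty.some

theorem point_mem (z : CenteredSeq b) (i : ℕ) : z.point ∈ b (z.seq i) :=
  mem_iInter.1 z.nonempty.some_mem i

theorem point_mem_head (z : CenteredSeq b) (n : ℕ) : z.point ∈ z.head n :=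
  mem_head.2 fun i _ => z.point_mem i

variable [TopologicalSpace X]

theorem isOpen_head (hb : TopologicalSpace.IsTopologicalBasis (range b)) (z : CenteredSeq b)
    (n : ℕ) : IsOpen (z.head n) :=
  (Set.finite_lt_nat n).isOpen_biInter fun _ _ => hb.isOpen (mem_range_self _)

/-- A basic set around a common point of `W` and the head, repeated forever, keeps that point
common. -/
theorem exists_extension (hb : TopologicalSpace.IsTopologicalBasis (range b)) (z : CenteredSeq b)
    (n : ℕ) {W : Set X} (hW : IsOpen W) (hne : (W ∩ z.head n).Nonempty) :
    ∃ z' : CenteredSeq b, (∀ i < n, z'.seq i = z.seq i) ∧ b (z'.seq n) ⊆ W := by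
  obtain ⟨x, hx⟩ := hne
  obtain ⟨_, ⟨v, rfl⟩, hxv, hvW⟩ := hb.exists_subset_of_mem_open hx
    (hW.inter (isOpen_head hb z n))
  refine ⟨⟨fun i => if i < n then z.seq i else v, x, mem_iInter.2 fun i => ?_⟩, fun i hi => ?_, ?_⟩
  · by_cases hi : i < n
    · simpa only [hi, if_true] using mem_head.1 hx.2 i hi
    · simpa only [hi, if_false] using hxv
  · simp only [hi, if_true]
  · simpa only [lt_irrefl, if_false] using hvW.trans inter_subset_left

variable [TopologicalSpace B]

instance : TopologicalSpace (CenteredSeq b) := TopologicalSpace.induced seq Pi.topologicalSpace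

omit [TopologicalSpace X] in
theorem isInducing_seq : IsInducing (seq : CenteredSeq b → ℕ → B) := ⟨rfl⟩

variable [DiscreteTopology B]

omit [TopologicalSpace X] in
theorem metrizableSpace : TopologicalSpace.MetrizableSpace (CenteredSeq b) := by
  have : TopologicalSpace.IsCompletelyMetrizableSpace (ℕ → B) := inferInstance
  exact IsEmbedding.metrizableSpace ⟨isInducing_seq (b := b), fun _ _ => CenteredSeq.ext⟩

omit [TopologicalSpace X] in
theorem isOpen_cylinder (z : CenteredSeq b) (n : ℕ) :
    IsOpen {z' : CenteredSeq b | ∀ i < n, z'.seq i = z.seq i} :=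
  (PiNat.isOpen_cylinder (E := fun _ : ℕ => B) z.seq n).preimage isInducing_seq.continuous

omit [TopologicalSpace X] in
theorem exists_cylinder_subset {z : CenteredSeq b} {O : Set (CenteredSeq b)} (hO : O ∈ 𝓝 z) :
    ∃ n, ∀ z' : CenteredSeq b, (∀ i < n, z'.seq i = z.seq i) → z' ∈ O := by
  rw [isInducing_seq.nhds_eq_comap] at hO
  obtain ⟨V, hV, hVO⟩ := hO
  obtain ⟨_, ⟨y, n, rfl⟩, hzc, hcV⟩ :=
    (PiNat.isTopologicalBasis_cylinders fun _ : ℕ => B).mem_nhds_iff.1 hV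
  exact ⟨n, fun z' h => hVO (hcV fun i hi => (h i hi).trans (hzc i hi))⟩

/-- However the points are chosen, fixing one more term of the sequence confines the chosen points
on the whole cylinder to that basic set. -/
theorem quasicontinuous_point (hb : TopologicalSpace.IsTopologicalBasis (range b)) :
    Quasicontinuous (point : CenteredSeq b → X) := by
  intro z O hO W hW
  obtain ⟨n, hn⟩ := exists_cylinder_subset hO
  obtain ⟨V, hVW, hV, hzV⟩ := mem_nhds_iff.1 hW
  obtain ⟨z', hz', hz'V⟩ := exists_extension hb z n hV ⟨_, hzV, z.point_mem_head n⟩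
  refine ⟨_, isOpen_cylinder z' (n + 1), ⟨z', fun _ _ => rfl⟩, fun y hy => hn y fun i hi => ?_,
    fun y hy => hVW (hz'V ?_)⟩
  · rw [hy i (hi.trans n.lt_succ_self), hz' i hi]
  · rw [← hy n n.lt_succ_self]
    exact y.point_mem n

/-- If a head left a closed neighborhood of the value, some extension of it would have its next
term, hence its chosen point, outside that neighborhood, against continuity. -/
theorem exists_head_subset [RegularSpace X] (hb : TopologicalSpace.IsTopologicalBasis (range b))
    {z : CenteredSeq b} (hz : ContinuousAt point z) {W : Set X} (hW : W ∈ 𝓝 z.point) :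
    ∃ n, z.head n ⊆ W := by
  obtain ⟨V, ⟨hV, hVc⟩, hVW⟩ := (closed_nhds_basis z.point).mem_iff.1 hW
  obtain ⟨n, hn⟩ := exists_cylinder_subset (hz hV)
  refine ⟨n, fun x hx => hVW ?_⟩
  by_contra hxV
  obtain ⟨z', hz', hz'V⟩ := exists_extension hb z n hVc.isOpen_compl ⟨x, hxV, hx⟩
  exact hz'V (z'.point_mem n) (hn z' hz')

end CenteredSeq

end BasicSequences

/-- A regular Baire space that is Piotrowski for metrizable spaces of density at most its weight
has a sequence of disjoint open families with dense unions which contain neighborhood bases. -/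
theorem IsPiotrowskiFor.exists_isBasicLevels {X : Type u} [TopologicalSpace X] [T3Space X]
    [BaireSpace X] [Nonempty X] {B : Type u} [Infinite B] {b : B → Set X}
    (hb : TopologicalSpace.IsTopologicalBasis (range b))
    (hX : IsPiotrowskiFor.{u, u} (BaireMetrizableOfDensityLE (Cardinal.mk B)) X) :
    ∃ F : ℕ → Set (Set X), IsBasicLevels F := by
  let : TopologicalSpace B := ⊥
  have : DiscreteTopology B := ⟨rfl⟩
  have := CenteredSeq.metrizableSpace (b := b)
  obtain ⟨D, hDo, hDd, hDC⟩ := hX.exists_dense_open (Z := CenteredSeq b)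
    (fun A => density_le_of_isInducing (CenteredSeq.isInducing_seq.comp IsInducing.subtypeVal))
    (CenteredSeq.quasicontinuous_point hb)
  obtain ⟨x₀⟩ := ‹Nonempty X›
  obtain ⟨_, ⟨v, rfl⟩, hv, -⟩ := hb.exists_subset_of_mem_open (mem_univ x₀) isOpen_univ
  let z₀ : CenteredSeq b := ⟨fun _ => v, x₀, mem_iInter.2 fun _ => hv⟩
  -- A node `(z, n)` stands for the first `n` terms of `z`; a step at level `k` lengthens them until
  -- the cylinder lies in `D k`.
  refine (exists_isBasicLevels_of_tree
    (fun t : CenteredSeq b × ℕ => t.1.head t.2) (fun t => t.1.isOpen_head hb t.2)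
    (fun t => ⟨_, t.1.point_mem_head t.2⟩)
    (fun k t t' => t.2 < t'.2 ∧ (∀ i < t.2, t'.1.seq i = t.1.seq i) ∧
      ∀ y : CenteredSeq b, (∀ i < t'.2, y.seq i = t'.1.seq i) → y ∈ D k)
    (z₀, 0) (by simp [CenteredSeq.head]) ?_ ?_ ?_).imp fun F hF => hF.1
  · rintro k ⟨z, n⟩ ⟨z', n'⟩ ⟨hn, hz, -⟩
    exact (z'.head_anti hn.le).trans (CenteredSeq.head_congr hz).le
  · rintro k ⟨z, n⟩ W hW ⟨x, hx⟩ hWz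
    obtain ⟨z', hz', hz'W⟩ := CenteredSeq.exists_extension hb z n hW ⟨x, hx, hWz hx⟩
    obtain ⟨y, hy, hyD⟩ := dense_iff_inter_open.1 (hDd k) _
      (CenteredSeq.isOpen_cylinder z' (n + 1)) ⟨z', fun _ _ => rfl⟩
    obtain ⟨m, hm⟩ := CenteredSeq.exists_cylinder_subset ((hDo k).mem_nhds hyD)
    -- Length `m` secures `D k`; length `n + 1` counts the term lying in `W` and makes the length
    -- grow.
    refine ⟨(y, max m (n + 1)), ⟨lt_max_of_lt_right n.lt_succ_self, fun i hi => ?_, fun w hw => ?_⟩,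
      fun a ha => hz'W ?_⟩
    · exact (hy i (Nat.lt_succ_of_lt hi)).trans (hz' i hi)
    · exact hm w fun i hi => hw i (lt_max_of_lt_left hi)
    · rw [← hy n n.lt_succ_self]
      exact CenteredSeq.mem_head.1 ha n (lt_max_of_lt_right n.lt_succ_self)
  · intro c h0 hc x hx W hW
    have hlt : ∀ k, (c k).2 < (c (k + 1)).2 := fun k => (hc k).1
    have hmono : StrictMono fun k => (c k).2 := strictMono_nat_of_lt_succ hlt
    have hagree : ∀ k l, k ≤ l → ∀ i < (c k).2, (c l).1.seq i = (c k).1.seq i := by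
      intro k l hkl
      induction l, hkl using Nat.le_induction with
      | base => exact fun _ _ => rfl
      | succ l hkl ih =>
        intro i hi
        rw [(hc l).2.1 i (hi.trans_le (hmono.monotone hkl)), ih i hi]
    have hid : ∀ i, i < (c (i + 1)).2 := fun i => hmono.le_apply (x := i + 1)
    -- The limit of the branch: node `i + 1` has length greater than `i`, so its term `i` is final.
    let s : ℕ → B := fun i => (c (i + 1)).1.seq i
    have hs : ∀ k, ∀ i < (c k).2, s i = (c k).1.seq i := by
      intro k i hi
      rcases le_total k (i + 1) with h | h
      · exact hagree k (i + 1) h i hi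
      · exact (hagree (i + 1) k h i (hid i)).symm
    have hxs : ∀ i, x ∈ b (s i) := fun i => CenteredSeq.mem_head.1 (hx (i + 1)) i (hid i)
    let z : CenteredSeq b := ⟨s, x, mem_iInter.2 hxs⟩
    have hz : ContinuousAt CenteredSeq.point z := by
      refine hDC (mem_iInter.2 fun k => (hc k).2.2 z (hs (k + 1)))
    -- The heads shrink to the chosen point and all contain `x`.
    have hxz : x = z.point := by
      by_contra hne
      obtain ⟨n, hn⟩ := CenteredSeq.exists_head_subset hb hz
        (isOpen_compl_singleton.mem_nhds (Ne.symm hne) : {x}ᶜ ∈ 𝓝 z.point)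
      exact hn (CenteredSeq.mem_head.2 fun i _ => hxs i) rfl
    obtain ⟨n, hn⟩ := CenteredSeq.exists_head_subset hb hz (hxz ▸ hW)
    refine ⟨n, Subset.trans ?_ hn⟩
    have : (c n).1.head (c n).2 = z.head (c n).2 := (CenteredSeq.head_congr (hs n)).symm
    exact this.le.trans (z.head_anti hmono.le_apply)

/-! ### Positions and plays of the Choquet game -/

open TopologicalSpace (Opens)

variable {X : Type u} [TopologicalSpace X]

theorem history_congr {U V U' V' : ℕ → Opens X} {n : ℕ} (hU : ∀ i < n, U' i = U i)
    (hV : ∀ i < n, V' i = V i) : history U' V' n = history U V n := by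
  refine List.map_congr_left fun i hi => ?_
  rw [hU i (List.mem_range.1 hi), hV i (List.mem_range.1 hi)]

theorem IsPartialPlay.congr {U V U' V' : ℕ → Opens X} {n : ℕ} (h : IsPartialPlay U V n)
    (hU : ∀ i < n, U' i = U i) (hV : ∀ i < n, V' i = V i) : IsPartialPlay U' V' n where
  start hn := by rw [hU 0 hn, h.start hn]
  nonempty_left i hi := by rw [hU i hi]; exact h.nonempty_left i hi
  nonempty_right i hi := by rw [hV i hi]; exact h.nonempty_right i hi
  right_le_left i hi := by rw [hU i hi, hV i hi]; exact h.right_le_left i hi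
  left_le_right i hi := by
    rw [hU _ hi, hV _ (Nat.lt_of_succ_lt hi)]
    exact h.left_le_right i hi

/-- A position of the Choquet game in which the player `α` has to move. -/
structure Position (X : Type u) [TopologicalSpace X] where
  /-- The moves of `α`. -/
  U : ℕ → Opens X
  /-- The moves of `β`. -/
  V : ℕ → Opens X
  /-- The number of rounds played. -/
  n : ℕ
  play : IsPartialPlay U V n

namespace Position

variable {σ : List (Opens X × Opens X) → Opens X}

/-- The initial position. -/
def initial (X : Type u) [TopologicalSpace X] : Position X :=
  ⟨fun _ => ⊤, fun _ => ⊤, 0, by constructor <;> simp⟩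

/-- The next move of the player `α` who follows `σ`. -/
def next (σ : List (Opens X × Opens X) → Opens X) (t : Position X) : Opens X :=
  if t.n = 0 then ⊤ else σ (history t.U t.V t.n)

/-- The position `t'` arises from `t` after a move of `α` according to `σ` and a move of `β`. -/
structure Step (σ : List (Opens X × Opens X) → Opens X) (t t' : Position X) : Prop where
  n_eq : t'.n = t.n + 1
  U_eq : ∀ i < t.n, t'.U i = t.U i
  V_eq : ∀ i < t.n, t'.V i = t.V i
  move : t'.U t.n = t.next σ

theorem next_initial : (initial X).next σ = ⊤ := rfl

theorem next_nonempty [Nonempty X] (hσ : IsWinningStrategy σ) (t : Position X) :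
    (t.next σ : Set X).Nonempty := by
  obtain ⟨U, V, n, h⟩ := t
  cases n with
  | zero => exact univ_nonempty
  | succ n => exact (hσ.legal U V n h).1

theorem next_le (hσ : IsWinningStrategy σ) {t : Position X} {n : ℕ} (hn : t.n = n + 1) :
    t.next σ ≤ t.V n := by
  obtain ⟨U, V, m, h⟩ := t
  obtain rfl : m = n + 1 := hn
  exact (hσ.legal U V n h).2

theorem Step.next_le {t t' : Position X} (hσ : IsWinningStrategy σ) (h : Step σ t t') :
    t'.next σ ≤ t.next σ := by
  rw [← h.move]
  exact (Position.next_le hσ h.n_eq).trans (t'.play.right_le_left _ (by simp [h.n_eq]))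

/-- Any nonempty open subset of the pending move of `α` is a legal move of `β`, and the answer of
`α` stays inside it. This gives the cofinality that the tree requires. -/
theorem exists_step (hσ : IsWinningStrategy σ) (t : Position X) {W : Set X} (hW : IsOpen W)
    (hne : W.Nonempty) (hWt : W ⊆ t.next σ) : ∃ t', Step σ t t' ∧ (t'.next σ : Set X) ⊆ W := by
  classical
  have hU : ∀ i < t.n, Function.update t.U t.n (t.next σ) i = t.U i := fun i hi =>
    Function.update_of_ne hi.ne _ _
  have hV : ∀ i < t.n, Function.update t.V t.n ⟨W, hW⟩ i = t.V i := fun i hi =>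
    Function.update_of_ne hi.ne _ _
  have hp := t.play.congr hU hV
  have hcases : ∀ i, i < t.n + 1 → i < t.n ∨ i = t.n := fun i hi => Nat.lt_succ_iff_lt_or_eq.1 hi
  have hplay : IsPartialPlay (Function.update t.U t.n (t.next σ))
      (Function.update t.V t.n ⟨W, hW⟩) (t.n + 1) := by
    refine ⟨fun _ => ?_, fun i hi => ?_, fun i hi => ?_, fun i hi => ?_, fun i hi => ?_⟩
    · rcases Nat.eq_zero_or_pos t.n with h0 | h0
      · rw [h0, Function.update_self, next, if_pos h0]
      · exact hp.start h0
    · rcases hcases i hi with h | rfl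
      · exact hp.nonempty_left i h
      · rw [Function.update_self]
        exact hne.mono hWt
    · rcases hcases i hi with h | rfl
      · exact hp.nonempty_right i h
      · rw [Function.update_self]
        exact hne
    · rcases hcases i hi with h | rfl
      · exact hp.right_le_left i h
      · rw [Function.update_self, Function.update_self]
        exact hWt
    · rcases hcases (i + 1) hi with h | h
      · exact hp.left_le_right i h
      · rw [h, Function.update_self, hV i (by omega)]
        exact Position.next_le hσ h.symm
  refine ⟨⟨_, _, t.n + 1, hplay⟩, ⟨rfl, hU, hV, Function.update_self _ _ _⟩, ?_⟩
  have := Position.next_le hσ (t := ⟨_, _, t.n + 1, hplay⟩) rfl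
  exact this.trans (Function.update_self (f := t.V) t.n (⟨W, hW⟩ : Opens X)).le

/-- Successive positions agree on their common rounds, so reading round `k` off position `k + 1`
glues them into one play that follows `σ`. -/
theorem iInter_next_nonempty (hσ : IsWinningStrategy σ) {c : ℕ → Position X}
    (h0 : c 0 = initial X) (hc : ∀ k, Step σ (c k) (c (k + 1))) :
    (⋂ k, ((c k).next σ : Set X)).Nonempty := by
  have hn : ∀ k, (c k).n = k := by
    intro k
    induction k with
    | zero => rw [h0]; rfl
    | succ k ih => rw [(hc k).n_eq, ih]
  have hU : ∀ k, ∀ i < k, (c (i + 1)).U i = (c k).U i := by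
    intro k i hi
    induction k, Nat.succ_le_of_lt hi using Nat.le_induction with
    | base => rfl
    | succ k hk ih => rw [ih hk, (hc k).U_eq i (by rw [hn]; exact hk)]
  have hV : ∀ k, ∀ i < k, (c (i + 1)).V i = (c k).V i := by
    intro k i hi
    induction k, Nat.succ_le_of_lt hi using Nat.le_induction with
    | base => rfl
    | succ k hk ih => rw [ih hk, (hc k).V_eq i (by rw [hn]; exact hk)]
  have hmove : ∀ k, (c (k + 1)).U k = (c k).next σ := fun k => by
    have := (hc k).move
    rwa [hn] at this
  have hwin := hσ.wins (fun k => (c (k + 1)).U k) (fun k => (c (k + 1)).V k) (fun k => by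
    have := (c k).play
    rw [hn] at this
    exact this.congr (hU k) (hV k)) (fun k => by
    rw [hmove, next, hn, if_neg k.succ_ne_zero, history_congr (hU (k + 1)) (hV (k + 1))])
  simpa only [hmove] using hwin

end Position

/-- Let `β` move into `O` and into one dense open set per round; the point won by `α` lies in all of
them. -/
theorem IsChoquet.baireSpace (hX : IsChoquet X) : BaireSpace X := by
  obtain ⟨σ, hσ⟩ := hX
  refine ⟨fun D hDo hDd => dense_iff_inter_open.2 fun O hO hOne => ?_⟩
  have key : ∀ t : {t : Position X // (O ∩ t.next σ).Nonempty},
      ∃ t' : {t : Position X // (O ∩ t.next σ).Nonempty}, Position.Step σ t.1 t'.1 ∧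
        (t'.1.next σ : Set X) ⊆ O ∩ D t.1.n := by
    rintro ⟨t, ht⟩
    have : Nonempty X := ⟨hOne.some⟩
    have hW : ((O ∩ t.next σ) ∩ D t.n).Nonempty :=
      dense_iff_inter_open.1 (hDd t.n) _ (hO.inter (t.next σ).isOpen) ht
    obtain ⟨t', hs, ht'⟩ := t.exists_step hσ ((hO.inter (t.next σ).isOpen).inter (hDo t.n)) hW
      fun x hx => hx.1.2
    obtain ⟨x, hx⟩ := t'.next_nonempty hσ
    exact ⟨⟨t', x, (ht' hx).1.1, hx⟩, hs, fun y hy => ⟨(ht' hy).1.1, (ht' hy).2⟩⟩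
  choose g hg hgD using key
  let c : ℕ → {t : Position X // (O ∩ t.next σ).Nonempty} := fun k =>
    Nat.rec ⟨Position.initial X, by simpa [Position.next_initial] using hOne⟩ (fun _ t => g t) k
  have hc : ∀ k, c (k + 1) = g (c k) := fun _ => rfl
  have hn : ∀ k, (c k).1.n = k := by
    intro k
    induction k with
    | zero => rfl
    | succ k ih => rw [hc, (hg _).n_eq, ih]
  obtain ⟨x, hx⟩ := Position.iInter_next_nonempty hσ (c := fun k => (c k).1) rfl fun k => hg (c k)
  have hx' := fun k => hgD (c k) (mem_iInter.1 hx (k + 1))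
  refine ⟨x, (hx' 0).1, mem_iInter.2 fun k => ?_⟩
  have := (hx' k).2
  rwa [hn] at this

/-- A Choquet space with basic levels contains a dense completely metrizable `Gδ`-subspace. -/
theorem IsChoquet.exists_dense_isCompletelyMetrizableSpace [T2Space X] [Nonempty X]
    (hX : IsChoquet X) {F : ℕ → Set (Set X)} (hF : IsBasicLevels F) :
    ∃ s : Set X, Dense s ∧ IsGδ s ∧ TopologicalSpace.IsCompletelyMetrizableSpace s := by
  have := hX.baireSpace
  obtain ⟨σ, hσ⟩ := hX
  -- Branches are plays following `σ`, hence have a common point; entering a member of `F t.n` at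
  -- each step makes them neighborhood bases.
  obtain ⟨E, hE, hEc⟩ := exists_isBasicLevels_of_tree (fun t : Position X => (t.next σ : Set X))
    (fun t => (t.next σ).isOpen) (fun t => t.next_nonempty hσ)
    (fun _ t t' => Position.Step σ t t' ∧ ∃ w ∈ F t.n, (t'.next σ : Set X) ⊆ w)
    (Position.initial X) rfl (fun _ t t' h => h.1.next_le hσ) (by
      intro _ t W hW hne hWt
      obtain ⟨x, hxW, w, hw, hxw⟩ := dense_iff_inter_open.1 (hF.dense t.n) W hW hne
      obtain ⟨t', hs, ht'⟩ := t.exists_step hσ (hW.inter (hF.isOpen t.n w hw)) ⟨x, hxW, hxw⟩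
        (inter_subset_left.trans hWt)
      exact ⟨t', ⟨hs, w, hw, ht'.trans inter_subset_right⟩, ht'.trans inter_subset_left⟩) (by
      intro c h0 hc x hx W hW
      have hn : ∀ k, (c k).n = k := by
        intro k
        induction k with
        | zero => rw [h0]; rfl
        | succ k ih => rw [(hc k).1.n_eq, ih]
      choose w hw hcw using fun k => (hc k).2
      obtain ⟨k, hk⟩ := hF.base w x (fun k => by have := hw k; rwa [hn] at this)
        (fun k => hcw k (hx (k + 1))) W hW
      exact ⟨k + 1, (hcw k).trans hk⟩)
  refine ⟨_, hE.dense_iInter, hE.isGδ, hE.isCompletelyMetrizableSpace fun w hw hne => ?_⟩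
  obtain ⟨c, hcw, h0, hc⟩ := hEc w hw hne
  simp only [hcw]
  exact Position.iInter_next_nonempty hσ h0 fun k => (hc k).1

/-! ### Spaces with dense complete or Baire subspaces -/

/-- A regular space with a dense completely metrizable subspace is Choquet. -/
theorem isChoquet_of_dense [RegularSpace X] {s : Set X} (hs : Dense s)
    [TopologicalSpace.IsCompletelyMetrizableSpace s] : IsChoquet X := by
  classical
  let := TopologicalSpace.upgradeIsCompletelyMetrizable s
  have key : ∀ (V : Opens X) (n : ℕ), ∃ W : Opens X, (V : Set X).Nonempty →
      (W : Set X).Nonempty ∧ closure (W : Set X) ⊆ V ∧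
        ∀ x y : s, (x : X) ∈ W → (y : X) ∈ W → dist x y ≤ 1 / ((n : ℝ) + 1) := by
    intro V n
    by_cases hV : (V : Set X).Nonempty
    · obtain ⟨a, haV, has⟩ := dense_iff_inter_open.1 hs V V.isOpen hV
      have hr : (0 : ℝ) < 1 / ((n : ℝ) + 1) / 2 := by positivity
      obtain ⟨P, hP, hPb⟩ := (mem_nhds_subtype _ _ _).1 (Metric.ball_mem_nhds (⟨a, has⟩ : s) hr)
      obtain ⟨C, ⟨hC, hCc⟩, hCV⟩ := (closed_nhds_basis a).mem_iff.1
        (Filter.inter_mem (V.isOpen.mem_nhds haV) hP)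
      refine ⟨⟨interior C, isOpen_interior⟩, fun _ => ⟨⟨a, mem_interior_iff_mem_nhds.2 hC⟩,
        (closure_minimal interior_subset hCc).trans (hCV.trans inter_subset_left),
        fun x y hx hy => ?_⟩⟩
      have hx' : dist x ⟨a, has⟩ < _ := hPb (hCV (interior_subset hx)).2
      have hy' : dist y ⟨a, has⟩ < _ := hPb (hCV (interior_subset hy)).2
      have := dist_triangle_right x y ⟨a, has⟩
      linarith
    · exact ⟨⊤, fun h => absurd h hV⟩
  choose W hW using key
  have hlast : ∀ (U V : ℕ → Opens X) (n : ℕ),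
      (history U V (n + 1)).getLast? = some (U n, V n) := by
    intro U V n
    simp [history, List.range_succ]
  have hlen : ∀ (U V : ℕ → Opens X) (n : ℕ), (history U V n).length = n := by
    intro U V n
    simp [history]
  -- The answer depends only on the last move of `β` and the number of rounds; `⊤` is a dummy for
  -- the empty history.
  let σ : List (Opens X × Opens X) → Opens X := fun h =>
    (h.getLast?.map fun p => W p.2 h.length).getD ⊤
  have hσ : ∀ (U V : ℕ → Opens X) (n : ℕ), σ (history U V (n + 1)) = W (V n) (n + 1) := by
    intro U V n
    simp only [σ, hlast, hlen, Option.map_some, Option.getD_some]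
  refine ⟨σ, fun U V n hp => ?_, fun U V hp hU => ?_⟩
  · rw [hσ]
    obtain ⟨hne, hcl, -⟩ := hW (V n) (n + 1) (hp.nonempty_right n n.lt_succ_self)
    exact ⟨hne, subset_closure.trans hcl⟩
  · simp only [hσ] at hU
    have hW' : ∀ n, _ := fun n => hW (V n) (n + 1) ((hp (n + 1)).nonempty_right n n.lt_succ_self)
    simp only [← hU] at hW'
    have hcl : ∀ n, closure (U (n + 1) : Set X) ⊆ U n := fun n =>
      (hW' n).2.1.trans ((hp (n + 1)).right_le_left n n.lt_succ_self)
    have hanti : Antitone U := antitone_nat_of_succ_le fun n => subset_closure.trans (hcl n)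
    have hx : ∀ n, ∃ x : s, (x : X) ∈ U (n + 1) := fun n => by
      obtain ⟨x, hxU, hxs⟩ := dense_iff_inter_open.1 hs _ (U (n + 1)).isOpen (hW' n).1
      exact ⟨⟨x, hxs⟩, hxU⟩
    choose x hx using hx
    have hcauchy : CauchySeq x := by
      refine cauchySeq_of_le_tendsto_0' (fun n : ℕ => 1 / (((n + 1 : ℕ) : ℝ) + 1))
        (fun n m hnm => (hW' n).2.2 _ _ (hx n) (hanti (Nat.succ_le_succ hnm) (hx m))) ?_
      exact (Filter.tendsto_add_atTop_iff_nat 1).2 tendsto_one_div_add_atTop_nhds_zero_nat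
    obtain ⟨y, hy⟩ := cauchySeq_tendsto_of_complete hcauchy
    -- The limit lies in the closure of `U (n + 1)`, which is contained in `U n`.
    refine ⟨y, mem_iInter.2 fun n => hcl n (mem_closure_of_tendsto
      ((continuous_subtype_val.tendsto y).comp hy) ?_)⟩
    filter_upwards [Filter.eventually_ge_atTop n] with m hm
    exact hanti (Nat.succ_le_succ hm) (hx m)

theorem baireSpace_of_dense {s : Set X} (hs : Dense s) [BaireSpace s] : BaireSpace X := by
  refine ⟨fun D hDo hDd => ?_⟩
  have h : Dense (⋂ n, (Subtype.val ⁻¹' D n : Set s)) :=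
    dense_iInter_of_isOpen_nat (fun n => (hDo n).preimage continuous_subtype_val) fun n => by
      refine dense_iff_inter_open.2 ?_
      rintro _ ⟨O, hO, rfl⟩ ⟨x, hx⟩
      obtain ⟨y, hy⟩ := dense_iff_inter_open.1 (hDd n) O hO ⟨x, hx⟩
      obtain ⟨z, hz, hzs⟩ := dense_iff_inter_open.1 hs _ (hO.inter (hDo n)) ⟨y, hy⟩
      exact ⟨⟨z, hzs⟩, hz⟩
  refine dense_iff_inter_open.2 fun O hO hne => ?_
  obtain ⟨x, hxO, hxs⟩ := dense_iff_inter_open.1 hs O hO hne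
  obtain ⟨y, hyO, hy⟩ := dense_iff_inter_open.1 h _ (hO.preimage continuous_subtype_val)
    ⟨⟨x, hxs⟩, hxO⟩
  exact ⟨y, hyO, mem_iInter.2 fun n => mem_iInter.1 hy n⟩

/-! ### Weight and the final assembly -/

/-- Every space has a base of cardinality equal to its weight. -/
theorem exists_base_card_eq_weight (X : Type u) [TopologicalSpace X] :
    ∃ B : Set (Set X), TopologicalSpace.IsTopologicalBasis B ∧ Cardinal.mk B = weight X :=
  csInf_mem (s := {κ | ∃ B : Set (Set X), TopologicalSpace.IsTopologicalBasis B ∧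
    Cardinal.mk B = κ}) ⟨_, _, TopologicalSpace.isTopologicalBasis_opens, rfl⟩

/-- A space of finite weight that satisfies the separation axiom `T1` is discrete. -/
theorem discreteTopology_of_finite_base [T1Space X] {B : Set (Set X)}
    (hB : TopologicalSpace.IsTopologicalBasis B) (hfin : B.Finite) : DiscreteTopology X := by
  have : Finite X := by
    have := hfin.to_subtype
    refine Finite.of_injective (fun x : X => {b : B | x ∈ (b : Set X)}) fun x y hxy => ?_
    by_contra hne
    obtain ⟨b, hb, hxb, hbW⟩ := hB.exists_subset_of_mem_open
      (show x ∈ ({y}ᶜ : Set X) from hne) isOpen_compl_singleton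
    have hyb : (⟨b, hb⟩ : B) ∈ {b : B | y ∈ (b : Set X)} :=
      hxy.subset (show (⟨b, hb⟩ : B) ∈ {b : B | x ∈ (b : Set X)} from hxb)
    exact hbW hyb rfl
  infer_instance

/-- A regular Piotrowski Baire space is discrete or has basic levels. -/
theorem IsPiotrowskiFor.discreteTopology_or_exists_isBasicLevels [T3Space X] [BaireSpace X]
    [Nonempty X] (hX : IsPiotrowskiFor.{u, u} (BaireMetrizableOfDensityLE (weight X)) X) :
    DiscreteTopology X ∨ ∃ F : ℕ → Set (Set X), IsBasicLevels F := by
  obtain ⟨B, hB, hBw⟩ := exists_base_card_eq_weight X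
  -- The density bound by the number of finite words needs an infinite base.
  rcases B.finite_or_infinite with h | h
  · exact Or.inl (discreteTopology_of_finite_base hB h)
  · have := h.to_subtype
    rw [← hBw] at hX
    exact Or.inr (hX.exists_isBasicLevels (b := Subtype.val) (by rwa [Subtype.range_val]))

theorem IsPiotrowskiFor.exists_dense_isCompletelyMetrizableSpace [T3Space X]
    (hX : IsPiotrowskiFor.{u, u} (BaireMetrizableOfDensityLE (weight X)) X) (hC : IsChoquet X) :
    ∃ s : Set X, Dense s ∧ IsGδ s ∧ TopologicalSpace.IsCompletelyMetrizableSpace s := by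
  have := hC.baireSpace
  rcases isEmpty_or_nonempty X with h | h
  · exact ⟨univ, dense_univ, IsGδ.univ, inferInstance⟩
  rcases hX.discreteTopology_or_exists_isBasicLevels with h | ⟨F, hF⟩
  · exact ⟨univ, dense_univ, IsGδ.univ, inferInstance⟩
  · exact hC.exists_dense_isCompletelyMetrizableSpace hF

theorem IsPiotrowskiFor.exists_dense_metrizableSpace [T3Space X] [BaireSpace X]
    (hX : IsPiotrowskiFor.{u, u} (BaireMetrizableOfDensityLE (weight X)) X) :
    ∃ s : Set X, Dense s ∧ TopologicalSpace.MetrizableSpace s ∧ BaireSpace s := by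
  have hu : BaireSpace (univ : Set X) := isOpen_univ.baireSpace
  rcases isEmpty_or_nonempty X with h | h
  · exact ⟨univ, dense_univ, inferInstance, hu⟩
  rcases hX.discreteTopology_or_exists_isBasicLevels with h | ⟨F, hF⟩
  · exact ⟨univ, dense_univ, inferInstance, hu⟩
  · exact ⟨_, hF.dense_iInter, hF.metrizableSpace, hF.isGδ.baireSpace_of_dense hF.dense_iInter⟩

theorem IsPiotrowski.isPiotrowskiFor (hX : IsPiotrowski X) (κ : Cardinal.{u}) :
    IsPiotrowskiFor.{u, u} (BaireMetrizableOfDensityLE κ) X :=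
  fun Z _ hZ => hX Z hZ.1

end Piot

theorem theoremt (X : Type u) [TopologicalSpace X] [T35Space X] :
    (Piot.IsPiotrowskiFor.{u, u} (Piot.BaireMetrizableOfDensityLE (Piot.weight X)) X →
      ((∃ s : Set X, Dense s ∧ TopologicalSpace.IsCompletelyMetrizableSpace s) ↔
        Piot.IsChoquet X) ∧
      ((∃ s : Set X, Dense s ∧ IsGδ s ∧ TopologicalSpace.IsCompletelyMetrizableSpace s) ↔
        Piot.IsChoquet X)) ∧
    (Piot.IsPiotrowski X →
      ((∃ s : Set X, Dense s ∧ TopologicalSpace.MetrizableSpace s ∧ BaireSpace s) ↔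
        BaireSpace X) ∧
      ((∃ s : Set X, Dense s ∧ TopologicalSpace.IsCompletelyMetrizableSpace s) ↔
        Piot.IsChoquet X)) := by
  have hchoquet : ∀ s : Set X, Dense s → TopologicalSpace.IsCompletelyMetrizableSpace s →
      Piot.IsChoquet X := fun s hs _ => Piot.isChoquet_of_dense hs
  refine ⟨fun hX => ⟨⟨fun ⟨s, hs, hm⟩ => hchoquet s hs hm, fun hC => ?_⟩,
    fun ⟨s, hs, _, hm⟩ => hchoquet s hs hm, hX.exists_dense_isCompletelyMetrizableSpace⟩,
    fun hX => ⟨⟨fun ⟨s, hs, _, _⟩ => Piot.baireSpace_of_dense hs, fun _ => ?_⟩,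
    fun ⟨s, hs, hm⟩ => hchoquet s hs hm, fun hC => ?_⟩⟩
  · obtain ⟨s, hs, -, hm⟩ := hX.exists_dense_isCompletelyMetrizableSpace hC
    exact ⟨s, hs, hm⟩
  · exact (hX.isPiotrowskiFor _).exists_dense_metrizableSpace
  · obtain ⟨s, hs, -, hm⟩ := (hX.isPiotrowskiFor _).exists_dense_isCompletelyMetrizableSpace hC
    exact ⟨s, hs, hm⟩
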